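/- Let $B_0,B_1$ be real $d\times d$ Hurwitz matrices (all eigenvalues have negative real part) such that $X^T(B_i^T+B_i)X\le 0$ for all $X\in\mathbb{R}^d$ and $i=0,1$. Put $K=\ker(B_0^T+B_0)\cap\ker(B_1^T+B_1)$, and for $\lambda\in[0,1]$ put $B_\lambda=(1-\lambda)B_0+\lambda B_1$. Let $A_\lambda:K\to K$ and $C_\lambda:K\to K^\perp$ be the blocks of $B_\lambda$ in the orthogonal decomposition $\mathbb{R}^d=K\oplus K^\perp$, that is, $B_\lambda x=A_\lambda x+C_\lambda x$ for $x\in K$. Solutions of differential equations are understood in the sense of the integral equation. The switched system $\dot X=B_{u(t)}X$ is called GUAS (globally uniformly asymptotically stable) if for every measurable switching law $u:[0,+\infty)\to\{0,1\}$ and every initial condition in $\mathbb{R}^d$ the solution tends to $0$ as $t\to+\infty$. The bilinear system $\dot x=A_\lambda x,\ y=C_\lambda x$ on $K$ is called uniformly observable on $[0,+\infty)$ if for every measurable input $\lambda:[0,+\infty)\to[0,1]$ and all $x_1\ne x_2$ in $K$ the set $$\{t\ge 0:\ C_{\lambda(t)}x_1(t)\ne C_{\lambda(t)}x_2(t)\}$$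 has positive Lebesgue measure, where $x_i(t)$ is the solution of $\dot x=A_{\lambda(t)}x$ with $x_i(0)=x_i$. Then the switched system is GUAS if and only if the bilinear system is uniformly observable on $[0,+\infty)$. -/

import Mathlib

open MeasureTheory Filter Topology

noncomputable section

/-- `x` solves the linear time-varying equation `x' = L(t) x` on `[0, +∞)` with `x(0) = x₀`
in the Carathéodory sense: it is continuous and satisfies the integral equation
`x(t) = x₀ + ∫₀ᵗ L(s) x(s) ds`. -/
def IsTrajectory {V : Type*} [NormedAddCommGroup V] [NormedSpace ℝ V]
    (L : ℝ → V →L[ℝ] V) (x₀ : V) (x : ℝ → V) : Prop :=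
  ContinuousOn x (Set.Ici 0) ∧ ∀ t : ℝ, 0 ≤ t → x t = x₀ + ∫ s in (0 : ℝ)..t, L s (x s)

/-- Measurable inputs on `[0, +∞)` with values in `U` (an input is a function on the whole line
of which only the values at times `t ≥ 0` matter). -/
def IsInput (U : Set ℝ) (u : ℝ → ℝ) : Prop :=
  Measurable u ∧ ∀ t : ℝ, 0 ≤ t → u t ∈ U

/-- A real square matrix is Hurwitz if all its complex eigenvalues have negative real part. -/
def IsHurwitz {d : ℕ} (B : Matrix (Fin d) (Fin d) ℝ) : Prop :=
  ∀ z ∈ spectrum ℂ (B.map (fun r : ℝ => (r : ℂ))), z.re < 0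

/-- `Bᵀ + B ≤ 0` as a quadratic form. -/
def SymPartNonpos {d : ℕ} (B : Matrix (Fin d) (Fin d) ℝ) : Prop :=
  ∀ X : Fin d → ℝ, X ⬝ᵥ ((B.transpose + B).mulVec X) ≤ 0

/-- The operator on Euclidean space given by `B_lam = (1 - lam) B₀ + lam B₁`. -/
def convOp {d : ℕ} (B₀ B₁ : Matrix (Fin d) (Fin d) ℝ) (lam : ℝ) :
    EuclideanSpace ℝ (Fin d) →L[ℝ] EuclideanSpace ℝ (Fin d) :=
  Matrix.toEuclideanCLM (n := Fin d) (𝕜 := ℝ) ((1 - lam) • B₀ + lam • B₁)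

/-- The switched system `X' = B_{u(t)} X`, `u(t) ∈ {0, 1}`, is GUAS: for every measurable
switching law, every solution tends to `0`. -/
def IsGUAS {d : ℕ} (B₀ B₁ : Matrix (Fin d) (Fin d) ℝ) : Prop :=
  ∀ u : ℝ → ℝ, IsInput {0, 1} u →
    ∀ (X₀ : EuclideanSpace ℝ (Fin d)) (X : ℝ → EuclideanSpace ℝ (Fin d)),
      IsTrajectory (fun t => convOp B₀ B₁ (u t)) X₀ X → Tendsto X atTop (𝓝 0)

/-- `K = ker (B₀ᵀ + B₀) ∩ ker (B₁ᵀ + B₁)`. -/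
def spaceK {d : ℕ} (B₀ B₁ : Matrix (Fin d) (Fin d) ℝ) :
    Submodule ℝ (EuclideanSpace ℝ (Fin d)) :=
  LinearMap.ker (Matrix.toEuclideanLin (B₀.transpose + B₀)) ⊓
    LinearMap.ker (Matrix.toEuclideanLin (B₁.transpose + B₁))

/-- The block `A_lam : K → K` of `B_lam` in the decomposition `K ⊕ Kᗮ`. -/
def blockA {d : ℕ} (B₀ B₁ : Matrix (Fin d) (Fin d) ℝ) (lam : ℝ) :
    spaceK B₀ B₁ →L[ℝ] spaceK B₀ B₁ :=
  (spaceK B₀ B₁).orthogonalProjectionOnto ∘L convOp B₀ B₁ lam ∘L (spaceK B₀ B₁).subtypeL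

/-- The block `C_lam : K → Kᗮ` of `B_lam` in the decomposition `K ⊕ Kᗮ`. -/
def blockC {d : ℕ} (B₀ B₁ : Matrix (Fin d) (Fin d) ℝ) (lam : ℝ) :
    spaceK B₀ B₁ →L[ℝ] (spaceK B₀ B₁)ᗮ :=
  (spaceK B₀ B₁)ᗮ.orthogonalProjectionOnto ∘L convOp B₀ B₁ lam ∘L (spaceK B₀ B₁).subtypeL

/-- The bilinear system `x' = A_lam x`, `y = C_lam x` on `K` is uniformly observable on
`[0, +∞)`: for every measurable input with values in `[0, 1]`, the outputs produced by two
different initial states differ on a set of times of positive Lebesgue measure. -/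
def IsUniformlyObservable {d : ℕ} (B₀ B₁ : Matrix (Fin d) (Fin d) ℝ) : Prop :=
  ∀ lam : ℝ → ℝ, IsInput (Set.Icc 0 1) lam →
    ∀ (p₁ p₂ : spaceK B₀ B₁) (x₁ x₂ : ℝ → spaceK B₀ B₁), p₁ ≠ p₂ →
      IsTrajectory (fun t => blockA B₀ B₁ (lam t)) p₁ x₁ →
      IsTrajectory (fun t => blockA B₀ B₁ (lam t)) p₂ x₂ →
      0 < volume {t : ℝ | 0 ≤ t ∧ blockC B₀ B₁ (lam t) (x₁ t) ≠ blockC B₀ B₁ (lam t) (x₂ t)}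

end

/-! Dissipativity makes norms non-increasing, and an isotropic vector of `Bᵢᵀ + Bᵢ` lies in its
kernel. Both properties are shown equivalent to the absence of a nonzero solution of the relaxed
system (inputs in `[0, 1]`) that stays in `K`. Such a solution has constant norm and zero output, so
it cannot be distinguished from the zero solution.

If observability fails, the difference `Z` of two indistinguishable states satisfies `Z' = B_lam Z`
inside `K`. A two-valued law whose primitive stays within `2/N * exp (-t)` of that of `lam` gives a
genuine switched solution `X` with `X 0 = Z 0`. Since `Bᵢ` is skew against vectors of `K`, `⟪X, Z⟫`
varies only through the difference of the inputs; integration by parts bounds its total variation on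
the half-line by `O(1/N)`, so `X` does not decay (`not_tendsto_zero_of_chatter`).

Conversely, if `X` does not decay, its norm tends to some `c > 0`, and limits of translates of `X`
give a relaxed trajectory of constant norm `c` (`exists_isometric_trajectory`). If one quadratic
form were nonzero at a point of it, only the other matrix would act nearby, and isometrically, which
the Hurwitz property forbids (`inner_eq_zero_of_isometric`). So the limit lies in `K`, and its
output vanishes almost everywhere. -/

/-! ### Lipschitz functions, Carathéodory solutions and dissipation of the norm. -/

section Analysis

variable {V : Type*} [NormedAddCommGroup V] [NormedSpace ℝ V]
variable {E : Type*} [NormedAddCommGroup E] [InnerProductSpace ℝ E]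

/-- `x` is Lipschitz on every compact interval `[0, T]`. -/
def LocLip {V : Type*} [NormedAddCommGroup V] (x : ℝ → V) : Prop :=
  ∀ T : ℝ, ∃ C : NNReal, LipschitzOnWith C x (Set.Icc 0 T)

/-- Absolute continuity gives the fundamental theorem of calculus, so an almost everywhere sign
suffices; measurable inputs provide derivatives only almost everywhere. -/
lemma le_of_ae_deriv_nonneg {f : ℝ → ℝ} {a b : ℝ} (hab : a ≤ b)
    (hf : AbsolutelyContinuousOnInterval f a b)
    (h : ∀ᵐ t, t ∈ Set.Ioo a b → ∃ f', HasDerivAt f f' t ∧ 0 ≤ f') : f a ≤ f b := by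
  have h1 := hf.integral_deriv_eq_sub
  have h2 : 0 ≤ ∫ x in a..b, deriv f x := by
    rw [intervalIntegral.integral_of_le hab, integral_Ioc_eq_integral_Ioo]
    refine setIntegral_nonneg_of_ae_restrict ?_
    rw [EventuallyLE, ae_restrict_iff' measurableSet_Ioo]
    filter_upwards [h] with t ht hmem
    obtain ⟨f', h1, h2⟩ := ht hmem
    simpa [h1.deriv] using h2
  linarith

lemma LocLip.inner_apply {f g : ℝ → E} (hf : LocLip f) (hg : LocLip g) :
    LocLip (fun t => inner ℝ (f t) (g t)) := by
  intro T
  obtain ⟨C, hC⟩ := hf T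
  obtain ⟨C', hC'⟩ := hg T
  obtain ⟨M, hM⟩ := isCompact_Icc.exists_bound_of_continuousOn hC.continuousOn
  obtain ⟨M', hM'⟩ := isCompact_Icc.exists_bound_of_continuousOn hC'.continuousOn
  refine ⟨(|M| * C' + C * |M'|).toNNReal, LipschitzOnWith.of_dist_le_mul fun s hs t ht => ?_⟩
  rw [Real.coe_toNNReal _ (by positivity), Real.dist_eq]
  have e : inner ℝ (f s) (g s) - inner ℝ (f t) (g t)
      = inner ℝ (f s) (g s - g t) + inner ℝ (f s - f t) (g t) := by
    simp [inner_sub_left, inner_sub_right]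
  rw [e]
  have h1 := hC.dist_le_mul s hs t ht
  have h2 := hC'.dist_le_mul s hs t ht
  rw [dist_eq_norm] at h1 h2
  calc _ ≤ ‖f s‖ * ‖g s - g t‖ + ‖f s - f t‖ * ‖g t‖ :=
        (abs_add_le _ _).trans (add_le_add (abs_real_inner_le_norm _ _)
          (abs_real_inner_le_norm _ _))
    _ ≤ |M| * (C' * dist s t) + (C * dist s t) * |M'| := by
        gcongr
        · exact (hM s hs).trans (le_abs_self _)
        · exact (hM' t ht).trans (le_abs_self _)
    _ = _ := by ring

lemma LocLip.add {V : Type*} [NormedAddCommGroup V] {f g : ℝ → V} (hf : LocLip f) (hg : LocLip g) :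
    LocLip (fun t => f t + g t) := fun T => by
  obtain ⟨C, hC⟩ := hf T
  obtain ⟨C', hC'⟩ := hg T
  exact ⟨C + C', hC.add hC'⟩

lemma LocLip.clm_comp {W : Type*} [NormedAddCommGroup W] [NormedSpace ℝ W] {f : ℝ → V}
    (hf : LocLip f) (A : V →L[ℝ] W) : LocLip (fun t => A (f t)) := fun T => by
  obtain ⟨C, hC⟩ := hf T
  exact ⟨‖A‖₊ * C, A.lipschitz.comp_lipschitzOnWith hC⟩

lemma LocLip.absolutelyContinuous {V : Type*} [NormedAddCommGroup V] {f : ℝ → V} (hf : LocLip f) {a b : ℝ} (ha : 0 ≤ a)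
    (hab : a ≤ b) : AbsolutelyContinuousOnInterval f a b := by
  obtain ⟨C, hC⟩ := hf b
  refine (hC.mono ?_).absolutelyContinuousOnInterval
  rw [Set.uIcc_of_le hab]
  exact Set.Icc_subset_Icc_left ha

lemma affineCLM_norm_le (A₀ D : V →L[ℝ] V) {r : ℝ} (hr : r ∈ Set.Icc (0 : ℝ) 1) (v : V) :
    ‖A₀ v + r • D v‖ ≤ (‖A₀‖ + ‖D‖) * ‖v‖ := by
  calc ‖A₀ v + r • D v‖ ≤ ‖A₀ v‖ + ‖r • D v‖ := norm_add_le _ _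
    _ ≤ ‖A₀‖ * ‖v‖ + 1 * (‖D‖ * ‖v‖) := by
        rw [norm_smul]
        gcongr
        · exact A₀.le_opNorm v
        · rw [Real.norm_eq_abs, abs_le]; constructor <;> linarith [hr.1, hr.2]
        · exact D.le_opNorm v
    _ = _ := by ring

lemma affine_intervalIntegrable (A₀ D : V →L[ℝ] V) {u : ℝ → ℝ}
    (hu : IsInput (Set.Icc 0 1) u) {x : ℝ → V} (hx : ContinuousOn x (Set.Ici 0)) {a b : ℝ}
    (ha : 0 ≤ a) (hb : 0 ≤ b) :
    IntervalIntegrable (fun s => A₀ (x s) + u s • D (x s)) volume a b := by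
  have hsub : Set.uIcc a b ⊆ Set.Ici 0 := fun t ht => le_trans (le_min ha hb) ht.1
  have hi : IntervalIntegrable u volume a b := by
    refine (intervalIntegrable_const (c := (1 : ℝ))).mono_fun hu.1.aestronglyMeasurable ?_
    rw [EventuallyLE, ae_restrict_iff' measurableSet_uIoc]
    refine ae_of_all _ fun t ht => ?_
    have := hu.2 t (hsub (Set.uIoc_subset_uIcc ht))
    simp only [norm_one, Real.norm_eq_abs, abs_le]
    constructor <;> linarith [this.1, this.2]
  have hc := hx.mono hsub
  refine IntervalIntegrable.add (A₀.continuous.comp_continuousOn hc).intervalIntegrable ?_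
  exact hi.smul_continuousOn (D.continuous.comp_continuousOn hc)

lemma locLip_of_ae_bound {x : ℝ → V} {x₀ : V} {f : ℝ → V}
    (hx : ∀ t, 0 ≤ t → x t = x₀ + ∫ s in (0 : ℝ)..t, f s)
    (hf : ∀ a b, 0 ≤ a → 0 ≤ b → IntervalIntegrable f volume a b)
    (hb : ∀ T, ∃ M, ∀ t ∈ Set.Icc 0 T, ‖f t‖ ≤ M) : LocLip x := by
  intro T
  obtain ⟨M, hM⟩ := hb T
  refine ⟨M.toNNReal, LipschitzOnWith.of_dist_le_mul fun s hs t ht => ?_⟩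
  have hM0 : 0 ≤ M := (norm_nonneg _).trans (hM s hs)
  rw [Real.coe_toNNReal _ hM0, dist_eq_norm, hx s hs.1, hx t ht.1, add_sub_add_left_eq_sub,
    intervalIntegral.integral_interval_sub_left (hf 0 s le_rfl hs.1) (hf 0 t le_rfl ht.1),
    Real.dist_eq]
  exact intervalIntegral.norm_integral_le_of_norm_le_const fun r hr =>
    hM r ⟨(le_min ht.1 hs.1).trans (Set.uIoc_subset_uIcc hr).1,
      (Set.uIoc_subset_uIcc hr).2.trans (max_le ht.2 hs.2)⟩

section traj
variable {A₀ D : V →L[ℝ] V} {u : ℝ → ℝ} {L : ℝ → V →L[ℝ] V} {x₀ : V} {x : ℝ → V}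

/-- The affine form `A₀ + u t • D` covers both `convOp` on the whole space and `blockA` on `K`. -/
lemma IsTrajectory.eq_integral (hL : ∀ t v, L t v = A₀ v + u t • D v)
    (hx : IsTrajectory L x₀ x) (t : ℝ) (ht : 0 ≤ t) :
    x t = x₀ + ∫ s in (0 : ℝ)..t, (A₀ (x s) + u s • D (x s)) := by
  simpa only [hL] using hx.2 t ht

lemma IsTrajectory.locLip (hu : IsInput (Set.Icc 0 1) u)
    (hL : ∀ t v, L t v = A₀ v + u t • D v) (hx : IsTrajectory L x₀ x) : LocLip x := by
  refine locLip_of_ae_bound (hx.eq_integral hL)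
    (fun a b ha hb => affine_intervalIntegrable A₀ D hu hx.1 ha hb) fun T => ?_
  obtain ⟨M, hM⟩ := isCompact_Icc.exists_bound_of_continuousOn
    (hx.1.mono (Set.Icc_subset_Ici_self : Set.Icc 0 T ⊆ _))
  refine ⟨(‖A₀‖ + ‖D‖) * M, fun t ht => (affineCLM_norm_le A₀ D (hu.2 t ht.1) _).trans ?_⟩
  gcongr
  exact hM t ht

lemma IsTrajectory.ae_hasDerivAt [CompleteSpace V] (hu : IsInput (Set.Icc 0 1) u)
    (hL : ∀ t v, L t v = A₀ v + u t • D v) (hx : IsTrajectory L x₀ x) :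
    ∀ᵐ t, 0 < t → HasDerivAt x (A₀ (x t) + u t • D (x t)) t := by
  have h : ∀ n : ℕ, ∀ᵐ t, t ∈ Set.uIcc (0 : ℝ) n → ∀ c ∈ Set.uIcc (0 : ℝ) n,
      HasDerivAt (fun t => ∫ s in c..t, (A₀ (x s) + u s • D (x s)))
        (A₀ (x t) + u t • D (x t)) t := fun n =>
    (affine_intervalIntegrable A₀ D hu hx.1 le_rfl n.cast_nonneg).ae_hasDerivAt_integral
  filter_upwards [ae_all_iff.2 h] with t ht htpos
  obtain ⟨n, hn⟩ := exists_nat_ge t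
  have := (ht n (by rw [Set.uIcc_of_le (by positivity)]; exact ⟨htpos.le, hn⟩) 0
    Set.left_mem_uIcc).const_add x₀
  refine this.congr_of_eventuallyEq ?_
  filter_upwards [lt_mem_nhds htpos] with s hs using hx.eq_integral hL s hs.le

end traj

/-- Norms do not increase along dissipative dynamics. -/
lemma norm_le_of_ae_dissipative {x x' : ℝ → E} (hx : LocLip x)
    (hd : ∀ᵐ t, 0 < t → HasDerivAt x (x' t) t)
    (hdiss : ∀ᵐ t, 0 < t → inner ℝ (x t) (x' t) ≤ 0) {a b : ℝ} (ha : 0 ≤ a) (hab : a ≤ b) :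
    ‖x b‖ ≤ ‖x a‖ := by
  have h : - inner ℝ (x a) (x a) ≤ - inner ℝ (x b) (x b) := by
    refine le_of_ae_deriv_nonneg (f := fun t => - inner ℝ (x t) (x t)) hab ((hx.inner_apply hx).absolutelyContinuous ha hab).neg ?_
    filter_upwards [hd, hdiss] with t h1 h2 ht
    have ht0 := ha.trans_lt ht.1
    refine ⟨_, ((h1 ht0).inner ℝ (h1 ht0)).neg, ?_⟩
    rw [real_inner_comm (x t) (x' t)]
    linarith [h2 ht0]
  simp only [real_inner_self_eq_norm_sq, neg_le_neg_iff] at h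
  exact le_of_sq_le_sq h (norm_nonneg _) 

lemma inner_eq_zero_of_norm_const {x : ℝ → E} {x' : E} {c t : ℝ} (hc : ∀ᶠ s in 𝓝 t, ‖x s‖ = c)
    (hd : HasDerivAt x x' t) : inner ℝ (x t) x' = 0 := by
  have h1 := hd.inner ℝ hd
  have h2 : HasDerivAt (fun t => inner ℝ (x t) (x t)) 0 t := by
    refine (hasDerivAt_const t (c ^ 2)).congr_of_eventuallyEq ?_
    filter_upwards [hc] with s hs
    rw [real_inner_self_eq_norm_sq, hs]
  have := h1.unique h2
  rw [real_inner_comm (x t) x'] at this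
  linarith

end Analysis
open scoped BoundedContinuousFunction

/-! ### Global solutions by Picard iteration in a weighted norm. -/

section Existence

variable {V : Type*} [NormedAddCommGroup V] [NormedSpace ℝ V] [CompleteSpace V]

/-- Linear equations with measurable bounded coefficients have global solutions. -/
theorem exists_isTrajectory {A₀ D : V →L[ℝ] V} {u : ℝ → ℝ} {L : ℝ → V →L[ℝ] V}
    (hu : IsInput (Set.Icc 0 1) u) (hL : ∀ t v, L t v = A₀ v + u t • D v) (x₀ : V) :
    ∃ x, IsTrajectory L x₀ x := by
  set M : ℝ := ‖A₀‖ + ‖D‖ + 1 with hM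
  have hM1 : 1 ≤ M := by rw [hM]; linarith [norm_nonneg A₀, norm_nonneg D]
  -- The weight exponent is twice the Lipschitz bound, which makes the Picard map a contraction of
  -- ratio `1/2` on the whole half-line.
  set k : ℝ := 2 * M with hk
  have hkpos : 0 < k := by linarith
  -- the integrand of the Picard operator in the weighted variable `y = exp (-k t) x`
  set G : (ℝ → V) → ℝ → V := fun y s =>
    A₀ (Real.exp (k * s) • y s) + u s • D (Real.exp (k * s) • y s) with hG
  have hGint : ∀ y : ℝ →ᵇ V, ∀ a b : ℝ, 0 ≤ a → 0 ≤ b → IntervalIntegrable (G y) volume a b := by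
    intro y a b ha hb
    refine affine_intervalIntegrable A₀ D hu (x := fun s => Real.exp (k * s) • y s) ?_ ha hb
    exact Continuous.continuousOn (by fun_prop)
  have hGsub : ∀ (y z : ℝ →ᵇ V) (s : ℝ), 0 ≤ s →
      ‖G y s - G z s‖ ≤ M * (Real.exp (k * s) * dist y z) := by
    intro y z s hs
    have e : G y s - G z s = A₀ (Real.exp (k * s) • (y s - z s))
        + u s • D (Real.exp (k * s) • (y s - z s)) := by
      simp only [hG, map_smul, map_sub, smul_sub]; abel
    rw [e]
    refine (affineCLM_norm_le A₀ D (hu.2 s hs) _).trans ?_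
    rw [norm_smul, Real.norm_eq_abs, abs_of_pos (Real.exp_pos _), ← dist_eq_norm]
    have := y.dist_coe_le_dist (g := z) s
    gcongr
    linarith
  have hexp : ∀ t : ℝ, 0 ≤ t → ∀ c : ℝ, 0 ≤ c →
      ∫ s in (0 : ℝ)..t, M * (Real.exp (k * s) * c) = (Real.exp (k * t) - 1) / 2 * c := by
    intro t ht c hc
    have : ∀ s : ℝ, HasDerivAt (fun s => (Real.exp (k * s) - 1) / 2 * c)
        (M * (Real.exp (k * s) * c)) s := by
      intro s
      have h1 : HasDerivAt (fun s => k * s) k s := by simpa using (hasDerivAt_id s).const_mul k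
      refine (((h1.exp.sub_const 1).div_const 2).mul_const c).congr_deriv ?_
      rw [hk]; ring
    rw [intervalIntegral.integral_eq_sub_of_hasDerivAt (fun s _ => this s)
      (Continuous.intervalIntegrable (by fun_prop) _ _)]
    simp
  have hIsub : ∀ (y z : ℝ →ᵇ V) (t : ℝ), 0 ≤ t →
      ‖(∫ s in (0 : ℝ)..t, G y s) - ∫ s in (0 : ℝ)..t, G z s‖
        ≤ (Real.exp (k * t) - 1) / 2 * dist y z := by
    intro y z t ht
    rw [← intervalIntegral.integral_sub (hGint y 0 t le_rfl ht) (hGint z 0 t le_rfl ht),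
      ← hexp t ht _ dist_nonneg]
    refine intervalIntegral.norm_integral_le_of_norm_le ht ?_
      (Continuous.intervalIntegrable (by fun_prop) _ _)
    exact ae_of_all _ fun s hs => hGsub y z s hs.1.le
  have hIcont : ∀ y : ℝ →ᵇ V, ContinuousOn (fun t => ∫ s in (0 : ℝ)..t, G y s) (Set.Ici 0) := by
    intro y t ht
    have h1 := intervalIntegral.continuousOn_primitive_interval' (μ := volume) (f := G y)
      (b₁ := 0) (b₂ := t + 1) (a := 0) (hGint y 0 (t + 1) le_rfl (by simp at ht; linarith))
      Set.left_mem_uIcc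
    rw [Set.uIcc_of_le (by simp at ht; linarith)] at h1
    have h2 := h1 t ⟨ht, by linarith⟩
    refine h2.mono_of_mem_nhdsWithin ?_
    have : Set.Iio (t + 1) ∈ 𝓝 t := Iio_mem_nhds (by linarith)
    filter_upwards [self_mem_nhdsWithin, mem_nhdsWithin_of_mem_nhds this] with s h1 h2
    exact ⟨h1, le_of_lt h2⟩
  -- Replacing `t` by `max t 0` extends the Picard image by a constant to negative times, so that it
  -- is a bounded continuous function on `ℝ`.
  have hcont : ∀ y : ℝ →ᵇ V, Continuous fun t : ℝ =>
      Real.exp (-(k * max t 0)) • (x₀ + ∫ s in (0 : ℝ)..(max t 0), G y s) := by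
    intro y
    have : Continuous fun t : ℝ => ∫ s in (0 : ℝ)..(max t 0), G y s :=
      (hIcont y).comp_continuous (by fun_prop) fun t => le_max_right t 0
    fun_prop
  have hbound : ∀ y : ℝ →ᵇ V, ∀ t : ℝ,
      ‖Real.exp (-(k * max t 0)) • (x₀ + ∫ s in (0 : ℝ)..(max t 0), G y s)‖ ≤ ‖x₀‖ + ‖y‖ := by
    intro y t
    have ht : 0 ≤ max t 0 := le_max_right _ _
    have h1 := hIsub y 0 _ ht
    have e : G (0 : ℝ →ᵇ V) = 0 := by ext; simp [hG]
    rw [e] at h1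
    simp only [Pi.zero_apply, intervalIntegral.integral_zero, sub_zero, dist_zero_right] at h1
    rw [norm_smul, Real.norm_eq_abs, abs_of_pos (Real.exp_pos _)]
    have h2 : Real.exp (-(k * max t 0)) ≤ 1 := Real.exp_le_one_iff.2 (by nlinarith)
    have h3 : Real.exp (-(k * max t 0)) * Real.exp (k * max t 0) = 1 := by
      rw [← Real.exp_add]; simp
    have h4 := Real.exp_pos (-(k * max t 0))
    calc _ ≤ Real.exp (-(k * max t 0)) * (‖x₀‖ + (Real.exp (k * max t 0) - 1) / 2 * ‖y‖) := by
          gcongr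
          exact (norm_add_le _ _).trans (by gcongr)
      _ = Real.exp (-(k * max t 0)) * ‖x₀‖
          + (1 - Real.exp (-(k * max t 0))) / 2 * ‖y‖ := by linear_combination (‖y‖ / 2) * h3
      _ ≤ 1 * ‖x₀‖ + 1 * ‖y‖ := by gcongr; linarith
      _ = _ := by ring
  set T : (ℝ →ᵇ V) → (ℝ →ᵇ V) := fun y =>
    BoundedContinuousFunction.ofNormedAddCommGroup _ (hcont y) _ (hbound y) with hT
  have hTapp : ∀ y t, T y t =
      Real.exp (-(k * max t 0)) • (x₀ + ∫ s in (0 : ℝ)..(max t 0), G y s) := fun y t => rfl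
  have hcontr : ContractingWith (1 / 2) T := by
    refine ⟨by rw [← NNReal.coe_lt_coe]; norm_num, LipschitzWith.of_dist_le_mul fun y z => ?_⟩
    refine (BoundedContinuousFunction.dist_le (by positivity)).2 fun t => ?_
    have ht : 0 ≤ max t 0 := le_max_right _ _
    rw [hTapp, hTapp, dist_eq_norm, ← smul_sub, add_sub_add_left_eq_sub, norm_smul,
      Real.norm_eq_abs, abs_of_pos (Real.exp_pos _)]
    have h3 : Real.exp (-(k * max t 0)) * Real.exp (k * max t 0) = 1 := by
      rw [← Real.exp_add]; simp
    have h4 := Real.exp_pos (-(k * max t 0))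
    have h5 : 0 ≤ dist y z := dist_nonneg
    calc _ ≤ Real.exp (-(k * max t 0)) * ((Real.exp (k * max t 0) - 1) / 2 * dist y z) := by
          gcongr
          exact hIsub y z _ ht
      _ = (1 - Real.exp (-(k * max t 0))) / 2 * dist y z := by
          linear_combination (dist y z / 2) * h3
      _ ≤ 1 / 2 * dist y z := by gcongr; linarith
      _ = _ := by norm_num
  set y := ContractingWith.fixedPoint T hcontr
  have hy : T y = y := hcontr.fixedPoint_isFixedPt
  refine ⟨fun t => Real.exp (k * t) • y t, Continuous.continuousOn (by fun_prop), fun t ht => ?_⟩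
  have h1 : y t = Real.exp (-(k * t)) • (x₀ + ∫ s in (0 : ℝ)..t, G y s) := by
    conv_lhs => rw [← hy, hTapp, max_eq_left ht]
  simp only [hL]
  rw [h1, smul_smul, ← Real.exp_add, add_neg_cancel, Real.exp_zero, one_smul]

end Existence

/-! ### Kernel of the symmetric part of a dissipative operator. -/

section Algebra

variable {E : Type*} [NormedAddCommGroup E] [InnerProductSpace ℝ E] [CompleteSpace E]

lemma inner_add_adjoint (A : E →L[ℝ] E) (v w : E) :
    inner ℝ w ((A + A.adjoint) v) = inner ℝ w (A v) + inner ℝ v (A w) := by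
  rw [add_apply, inner_add_right, ContinuousLinearMap.adjoint_inner_right,
    real_inner_comm v (A w)]

/-- Isotropic vectors of a negative semidefinite form lie in its kernel. -/
lemma add_adjoint_apply_eq_zero {A : E →L[ℝ] E} (hA : ∀ v, inner ℝ v (A v) ≤ 0) {v : E}
    (hv : inner ℝ v (A v) = 0) : (A + A.adjoint) v = 0 := by
  set w := (A + A.adjoint) v with hw
  have h1 : inner ℝ w (A v) + inner ℝ v (A w) = ‖w‖ ^ 2 := by
    rw [← inner_add_adjoint, ← hw, real_inner_self_eq_norm_sq]
  have h2 : ∀ s : ℝ, s * ‖w‖ ^ 2 + s ^ 2 * inner ℝ w (A w) ≤ 0 := by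
    intro s
    have := hA (v + s • w)
    simp only [map_add, map_smul, inner_add_left, inner_add_right, inner_smul_left,
      inner_smul_right, hv, conj_trivial] at this
    rw [← h1]
    linarith
  by_contra hne
  have h3 : 0 < ‖w‖ ^ 2 := by positivity
  set q := inner ℝ w (A w)
  -- The form at `v + s • w` is `s * ‖w‖ ^ 2 + s ^ 2 * q`. This `s` is small enough that the linear
  -- term wins: `s * |q| ≤ ‖w‖ ^ 2 / 2`.
  have h4 := h2 (‖w‖ ^ 2 / (2 * (|q| + 1)))
  have h5 := neg_abs_le q
  set s := ‖w‖ ^ 2 / (2 * (|q| + 1)) with hs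
  have hq := abs_nonneg q
  have h6 : 0 < s := by positivity
  have h7 : s * (2 * (|q| + 1)) = ‖w‖ ^ 2 := by rw [hs]; field_simp
  have h8 : ‖w‖ ^ 2 + s * q ≤ 0 := by
    by_contra h; push Not at h
    nlinarith [mul_pos h6 h]
  nlinarith

/-- The condition `⟪v, A w⟫ = -⟪A v, w⟫` holds for `v` in the kernel of the symmetric part. -/
lemma inner_eq_neg_of_add_adjoint_eq_zero {A : E →L[ℝ] E} {v : E}
    (hv : (A + A.adjoint) v = 0) (w : E) : inner ℝ v (A w) = - inner ℝ w (A v) := by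
  have := inner_add_adjoint A v w
  rw [hv, inner_zero_right] at this
  linarith

end Algebra

/-! ### Hurwitz matrices have no isometric orbits; translation to Euclidean operators. -/

section Hurwitz

variable {d : ℕ}

-- Over `ℂ`, the vectors whose whole `B`-orbit is killed by `Bᵀ + B` form a `B`-invariant subspace.
-- If it were nonzero it would contain an eigenvector `w`, and `w* (Bᵀ + B) w = 2 Re μ ‖w‖²` would
-- force `Re μ = 0`.
open Matrix ComplexOrder in
lemma IsHurwitz.eq_zero_of_forall_pow {B : Matrix (Fin d) (Fin d) ℝ} (hB : IsHurwitz B)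
    {v : Fin d → ℝ} (hv : ∀ n : ℕ, (B.transpose + B) *ᵥ (B ^ n *ᵥ v) = 0) : v = 0 := by
  set Bc : Matrix (Fin d) (Fin d) ℂ := B.map (fun r : ℝ => (r : ℂ)) with hBc
  let W : Submodule ℂ (Fin d → ℂ) :=
    { carrier := {w | ∀ n : ℕ, (Bc.transpose + Bc) *ᵥ (Bc ^ n *ᵥ w) = 0}
      add_mem' := fun {a b} ha hb n => by simp [mulVec_add, ha n, hb n]
      zero_mem' := fun n => by simp
      smul_mem' := fun c a ha n => by simp [mulVec_smul, ha n] }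
  have hinv : ∀ w ∈ W, Matrix.toLin' Bc w ∈ W := by
    intro w hw n
    have := hw (n + 1)
    rw [pow_succ, ← mulVec_mulVec] at this
    simpa using this
  by_contra hne
  have hpow : ∀ n, Bc ^ n = (B ^ n).map (fun r : ℝ => (r : ℂ)) := fun n =>
    (Matrix.map_pow B Complex.ofRealHom n).symm
  have hvW : (fun i => (v i : ℂ)) ∈ W := by
    intro n
    have hmul : ∀ (P : Matrix (Fin d) (Fin d) ℝ) (w : Fin d → ℝ),
        P.map (fun r : ℝ => (r : ℂ)) *ᵥ (fun i => (w i : ℂ)) = fun i => ((P *ᵥ w) i : ℂ) := by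
      intro P w
      ext i
      simp [mulVec, dotProduct]
    have hsum : Bc.transpose + Bc = (B.transpose + B).map (fun r : ℝ => (r : ℂ)) := by
      ext i j; simp [hBc]
    rw [hpow, hsum, hmul, hmul, hv n]
    ext i; simp
  have : Nontrivial W := by
    refine ⟨⟨_, hvW⟩, 0, fun h => hne ?_⟩
    ext i
    have := congrFun (congrArg Subtype.val h) i
    simpa using this
  obtain ⟨μ, hμ⟩ := Module.End.exists_eigenvalue ((Matrix.toLin' Bc).restrict hinv)
  obtain ⟨w, hw⟩ := hμ.exists_hasEigenvector
  have hw0 : (w : Fin d → ℂ) ≠ 0 := fun h => hw.2 (Subtype.ext h)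
  have hBw : Bc *ᵥ (w : Fin d → ℂ) = μ • (w : Fin d → ℂ) := by
    have := congrArg Subtype.val hw.apply_eq_smul
    simpa using this
  have hspec : μ ∈ spectrum ℂ Bc := by
    rw [← Matrix.spectrum_toLin']
    refine (Module.End.hasEigenvalue_of_hasEigenvector (x := (w : Fin d → ℂ)) ⟨?_, hw0⟩).mem_spectrum
    rw [Module.End.mem_eigenspace_iff]
    simpa using hBw
  have hneg := hB μ hspec
  have hS := w.2 0
  rw [pow_zero, one_mulVec, add_mulVec] at hS
  have hstar : star (Bc *ᵥ (w : Fin d → ℂ)) = Bc *ᵥ star (w : Fin d → ℂ) := by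
    ext i; simp [mulVec, dotProduct, hBc]
  have h1 : star (w : Fin d → ℂ) ⬝ᵥ (Bc.transpose *ᵥ (w : Fin d → ℂ))
      = star μ * (star (w : Fin d → ℂ) ⬝ᵥ (w : Fin d → ℂ)) := by
    rw [dotProduct_mulVec, vecMul_transpose, ← hstar, hBw, star_smul, smul_dotProduct, smul_eq_mul]
  have h2 : star (w : Fin d → ℂ) ⬝ᵥ (Bc *ᵥ (w : Fin d → ℂ))
      = μ * (star (w : Fin d → ℂ) ⬝ᵥ (w : Fin d → ℂ)) := by
    rw [hBw, dotProduct_smul, smul_eq_mul]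
  have h3 : (star μ + μ) * (star (w : Fin d → ℂ) ⬝ᵥ (w : Fin d → ℂ)) = 0 := by
    rw [add_mul, ← h1, ← h2, ← dotProduct_add, hS, dotProduct_zero]
  rcases mul_eq_zero.1 h3 with h | h
  · have := congrArg Complex.re h
    simp at this
    linarith
  · exact hw0 (dotProduct_star_self_eq_zero.1 h)

/-- The operator on Euclidean space given by `B`. -/
noncomputable abbrev euclOp (B : Matrix (Fin d) (Fin d) ℝ) :
    EuclideanSpace ℝ (Fin d) →L[ℝ] EuclideanSpace ℝ (Fin d) :=
  Matrix.toEuclideanCLM (n := Fin d) (𝕜 := ℝ) B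

lemma adjoint_euclOp (B : Matrix (Fin d) (Fin d) ℝ) :
    (euclOp B).adjoint = euclOp B.transpose := by
  have := map_star (Matrix.toEuclideanCLM (n := Fin d) (𝕜 := ℝ)) B
  rw [Matrix.star_eq_conjTranspose, Matrix.conjTranspose_eq_transpose_of_trivial] at this
  rw [euclOp, euclOp, this, ContinuousLinearMap.star_eq_adjoint]

lemma euclOp_add_adjoint (B : Matrix (Fin d) (Fin d) ℝ) :
    euclOp B + (euclOp B).adjoint = euclOp (B.transpose + B) := by
  rw [adjoint_euclOp, euclOp, euclOp, euclOp, map_add, add_comm]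

lemma SymPartNonpos.inner_nonpos {B : Matrix (Fin d) (Fin d) ℝ} (hB : SymPartNonpos B)
    (v : EuclideanSpace ℝ (Fin d)) : inner ℝ v (euclOp B v) ≤ 0 := by
  have h1 := hB v.ofLp
  have h2 := inner_add_adjoint (euclOp B) v v
  rw [euclOp_add_adjoint] at h2
  have h3 : inner ℝ v (euclOp (B.transpose + B) v)
      = v.ofLp ⬝ᵥ ((B.transpose + B).mulVec v.ofLp) := by
    rw [EuclideanSpace.inner_eq_star_dotProduct, dotProduct_comm]
    simp [euclOp, -map_add]
  rw [h3] at h2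
  linarith

lemma IsHurwitz.eq_zero_of_forall_pow_euclOp {B : Matrix (Fin d) (Fin d) ℝ} (hB : IsHurwitz B)
    {v : EuclideanSpace ℝ (Fin d)}
    (hv : ∀ n : ℕ, (euclOp B + (euclOp B).adjoint) ((euclOp B ^ n) v) = 0) : v = 0 := by
  have : v.ofLp = 0 := by
    refine hB.eq_zero_of_forall_pow fun n => ?_
    have := hv n
    rw [euclOp_add_adjoint, euclOp, euclOp, ← map_pow] at this
    simpa only [Matrix.ofLp_toEuclideanCLM, WithLp.ofLp_zero] using congrArg WithLp.ofLp this
  ext i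
  exact congrFun this i

lemma convOp_apply (B₀ B₁ : Matrix (Fin d) (Fin d) ℝ) (lam : ℝ) (v : EuclideanSpace ℝ (Fin d)) :
    convOp B₀ B₁ lam v = euclOp B₀ v + lam • (euclOp B₁ - euclOp B₀) v := by
  simp only [convOp, euclOp, map_add, map_smul, add_apply,
    smul_apply, sub_apply]
  module

lemma mem_spaceK {B₀ B₁ : Matrix (Fin d) (Fin d) ℝ} {v : EuclideanSpace ℝ (Fin d)} :
    v ∈ spaceK B₀ B₁ ↔ (euclOp B₀ + (euclOp B₀).adjoint) v = 0 ∧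
      (euclOp B₁ + (euclOp B₁).adjoint) v = 0 := by
  rw [euclOp_add_adjoint, euclOp_add_adjoint]
  rfl

end Hurwitz

/-! ### Two-valued switching laws approximating a relaxed input. -/

section Chattering

/-- Grid points `log (1 + k / N)`. -/
noncomputable def grid (N : ℕ) (k : ℕ) : ℝ := Real.log ((N + k : ℝ) / N)

/-- The index of the grid cell containing `t`. -/
noncomputable def cell (N : ℕ) (t : ℝ) : ℕ := ⌊(N : ℝ) * Real.exp t - N⌋₊

/-- On every grid cell, the law is equal to `1` for a time `∫ lam` and then equal to `0`. -/
noncomputable def chatter (N : ℕ) (lam : ℝ → ℝ) (t : ℝ) : ℝ :=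
  if t < grid N (cell N t) + ∫ s in (grid N (cell N t))..(grid N (cell N t + 1)), lam s
  then 1 else 0

variable {N : ℕ} {lam : ℝ → ℝ}

lemma grid_zero (hN : 0 < N) : grid N 0 = 0 := by
  have : (N : ℝ) ≠ 0 := by positivity
  simp [grid, this]

lemma grid_lt_succ (hN : 0 < N) (k : ℕ) : grid N k < grid N (k + 1) := by
  have : (0 : ℝ) < N := by positivity
  refine Real.log_lt_log (by positivity) ?_
  gcongr
  simp

lemma grid_nonneg (hN : 0 < N) (k : ℕ) : 0 ≤ grid N k := by
  have : (0 : ℝ) < N := by positivity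
  refine Real.log_nonneg ?_
  rw [le_div_iff₀ this]
  linarith [(k.cast_nonneg : (0 : ℝ) ≤ k)]

lemma grid_le_iff (hN : 0 < N) (k : ℕ) (t : ℝ) : grid N k ≤ t ↔ (k : ℝ) ≤ N * Real.exp t - N := by
  have : (0 : ℝ) < N := by positivity
  rw [grid, Real.log_le_iff_le_exp (by positivity), div_le_iff₀ this]
  constructor <;> intro h <;> linarith

lemma cell_eq (hN : 0 < N) {k : ℕ} {t : ℝ} (h1 : grid N k ≤ t) (h2 : t < grid N (k + 1)) :
    cell N t = k := by
  rw [grid_le_iff hN] at h1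
  rw [← not_le, grid_le_iff hN, not_le] at h2
  rw [cell, Nat.floor_eq_iff (le_trans k.cast_nonneg h1)]
  exact ⟨h1, by exact_mod_cast h2⟩

lemma grid_cell_le (hN : 0 < N) {t : ℝ} (ht : 0 ≤ t) : grid N (cell N t) ≤ t := by
  rw [grid_le_iff hN]
  refine Nat.floor_le ?_
  have := Real.one_le_exp ht
  have : (0 : ℝ) < N := by positivity
  nlinarith

lemma lt_grid_cell_succ (hN : 0 < N) (t : ℝ) : t < grid N (cell N t + 1) := by
  rw [← not_le, grid_le_iff hN, not_le]
  exact_mod_cast Nat.lt_floor_add_one _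

lemma measurable_chatter (N : ℕ) (lam : ℝ → ℝ) : Measurable (chatter N lam) := by
  have h1 : Measurable (cell N) := Nat.measurable_floor.comp (by fun_prop)
  refine Measurable.ite (measurableSet_lt measurable_id ?_) measurable_const measurable_const
  exact (measurable_from_nat (f := fun k =>
    grid N k + ∫ s in (grid N k)..(grid N (k + 1)), lam s)).comp h1

lemma chatter_mem (N : ℕ) (lam : ℝ → ℝ) (t : ℝ) : chatter N lam t ∈ ({0, 1} : Set ℝ) := by
  unfold chatter
  split_ifs <;> simp

lemma chatter_isInput (N : ℕ) (lam : ℝ → ℝ) : IsInput {0, 1} (chatter N lam) :=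
  ⟨measurable_chatter N lam, fun t _ => chatter_mem N lam t⟩

lemma IsInput.to_Icc {u : ℝ → ℝ} (hu : IsInput {0, 1} u) : IsInput (Set.Icc 0 1) u := by
  refine ⟨hu.1, fun t ht => ?_⟩
  rcases hu.2 t ht with h | h <;> rw [h] <;> simp

lemma IsInput.intervalIntegrable {u : ℝ → ℝ} (hu : IsInput (Set.Icc 0 1) u) {a b : ℝ}
    (ha : 0 ≤ a) (hb : 0 ≤ b) : IntervalIntegrable u volume a b := by
  have := affine_intervalIntegrable (V := ℝ) 0 (ContinuousLinearMap.id ℝ ℝ) hu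
    (x := fun _ => 1) continuousOn_const ha hb
  simpa using this

lemma IsInput.integral_mem {u : ℝ → ℝ} (hu : IsInput (Set.Icc 0 1) u) {a b : ℝ}
    (ha : 0 ≤ a) (hab : a ≤ b) : ∫ s in a..b, u s ∈ Set.Icc 0 (b - a) := by
  constructor
  · exact intervalIntegral.integral_nonneg hab fun t ht => (hu.2 t (ha.trans ht.1)).1
  · have := intervalIntegral.integral_mono_on hab (hu.intervalIntegrable ha (ha.trans hab))
      (intervalIntegrable_const (c := (1 : ℝ))) fun t ht => (hu.2 t (ha.trans ht.1)).2
    simpa using this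

/-- The integral of `lam` lies between `0` and the cell length, so the switching instant falls
inside the cell and the time spent at `1` is exactly that integral. -/
lemma integral_chatter_cell (hN : 0 < N) (hlam : IsInput (Set.Icc 0 1) lam) (k : ℕ) :
    ∫ s in (grid N k)..(grid N (k + 1)), chatter N lam s
      = ∫ s in (grid N k)..(grid N (k + 1)), lam s := by
  have hI := hlam.integral_mem (grid_nonneg hN k) (grid_lt_succ hN k).le
  set I := ∫ s in (grid N k)..(grid N (k + 1)), lam s with hIdef
  have hu := (chatter_isInput N lam).to_Icc
  have h0 := grid_nonneg hN k
  have h1 : 0 ≤ grid N k + I := add_nonneg h0 hI.1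
  have h2 := grid_nonneg hN (k + 1)
  rw [← intervalIntegral.integral_add_adjacent_intervals (b := grid N k + I)
    (hu.intervalIntegrable h0 h1) (hu.intervalIntegrable h1 h2)]
  have e1 : ∫ s in (grid N k)..(grid N k + I), chatter N lam s
      = ∫ s in (grid N k)..(grid N k + I), (1 : ℝ) := by
    refine intervalIntegral.integral_congr_Ioo_of_le (by linarith [hI.1]) fun t ht => ?_
    have := cell_eq hN ht.1.le (by linarith [ht.2, hI.2])
    simp only [chatter, this, ← hIdef, if_pos ht.2]
  have e2 : ∫ s in (grid N k + I)..(grid N (k + 1)), chatter N lam s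
      = ∫ s in (grid N k + I)..(grid N (k + 1)), (0 : ℝ) := by
    refine intervalIntegral.integral_congr_Ioo_of_le (by linarith [hI.2]) fun t ht => ?_
    have := cell_eq hN (by linarith [ht.1, hI.1]) ht.2
    simp only [chatter, this, ← hIdef, if_neg (not_lt.2 ht.1.le)]
  rw [e1, e2]
  simp

lemma integral_chatter_grid (hN : 0 < N) (hlam : IsInput (Set.Icc 0 1) lam) (k : ℕ) :
    ∫ s in (0 : ℝ)..(grid N k), chatter N lam s = ∫ s in (0 : ℝ)..(grid N k), lam s := by
  have hu := (chatter_isInput N lam).to_Icc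
  induction k with
  | zero => simp [grid_zero hN]
  | succ k ih =>
    have h0 := grid_nonneg hN k
    have h1 := grid_nonneg hN (k + 1)
    rw [← intervalIntegral.integral_add_adjacent_intervals (b := grid N k)
      (hu.intervalIntegrable le_rfl h0) (hu.intervalIntegrable h0 h1),
      ← intervalIntegral.integral_add_adjacent_intervals (b := grid N k)
      (hlam.intervalIntegrable le_rfl h0) (hlam.intervalIntegrable h0 h1), ih,
      integral_chatter_cell hN hlam]

/-- The switching law averages to the relaxed input with an exponentially decaying error. -/
theorem abs_integral_chatter_sub_le (hN : 0 < N) (hlam : IsInput (Set.Icc 0 1) lam) {t : ℝ}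
    (ht : 0 ≤ t) :
    |(∫ s in (0 : ℝ)..t, chatter N lam s) - ∫ s in (0 : ℝ)..t, lam s|
      ≤ 2 / N * Real.exp (-t) := by
  have hu := (chatter_isInput N lam).to_Icc
  set k := cell N t with hk
  have h0 := grid_nonneg hN k
  have h1 : grid N k ≤ t := grid_cell_le hN ht
  have h2 : t < grid N (k + 1) := lt_grid_cell_succ hN t
  rw [← intervalIntegral.integral_add_adjacent_intervals (b := grid N k)
      (hu.intervalIntegrable le_rfl h0) (hu.intervalIntegrable h0 ht),
      ← intervalIntegral.integral_add_adjacent_intervals (b := grid N k)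
      (hlam.intervalIntegrable le_rfl h0) (hlam.intervalIntegrable h0 ht),
      integral_chatter_grid hN hlam, add_sub_add_left_eq_sub]
  have h3 := hu.integral_mem h0 h1
  have h4 := hlam.integral_mem h0 h1
  have hNpos : (0 : ℝ) < N := by positivity
  have hk0 : (0 : ℝ) ≤ k := k.cast_nonneg
  -- The logarithmic spacing is chosen for this bound: the cell has length at most `1 / (N + k)`,
  -- and `N * exp t ≤ N + k + 1 ≤ 2 * (N + k)`. The error is therefore integrable in time.
  have h5 : t - grid N k ≤ 2 / N * Real.exp (-t) := by
    have h6 : grid N (k + 1) - grid N k ≤ 1 / (N + k) := by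
      rw [grid, grid, ← Real.log_div (by positivity) (by positivity)]
      refine (Real.log_le_sub_one_of_pos (by positivity)).trans (le_of_eq ?_)
      push_cast
      field_simp
      ring
    have h7 : Real.exp t ≤ (N + k + 1) / N := by
      have := (grid_le_iff hN (k + 1) t).not.1 h2.not_ge
      push_cast at this
      rw [le_div_iff₀ hNpos]
      nlinarith
    have h8 : 1 / (N + k : ℝ) ≤ 2 / N * Real.exp (-t) := by
      rw [Real.exp_neg, ← div_eq_mul_inv, div_div, div_le_div_iff₀ (by positivity) (by positivity)]
      have h9 : N * Real.exp t ≤ N + k + 1 := by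
        rw [le_div_iff₀ hNpos] at h7; linarith
      have : (1 : ℝ) ≤ N := by exact_mod_cast hN
      linarith
    linarith
  rw [abs_le]
  constructor <;> linarith [h3.1, h3.2, h4.1, h4.2]

end Chattering

/-! ### GUAS implies observability: chattering along a trajectory in `K`. -/

section Relaxation

lemma IsInput.locLip_integral {u : ℝ → ℝ} (hu : IsInput (Set.Icc 0 1) u) :
    LocLip fun t => ∫ s in (0 : ℝ)..t, u s := by
  refine locLip_of_ae_bound (x₀ := 0) (fun t _ => (zero_add _).symm)
    (fun a b ha hb => hu.intervalIntegrable ha hb) fun T => ⟨1, fun t ht => ?_⟩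
  have := hu.2 t ht.1
  rw [Real.norm_eq_abs, abs_le]
  constructor <;> linarith [this.1, this.2]

lemma IsInput.ae_hasDerivAt_integral {u : ℝ → ℝ} (hu : IsInput (Set.Icc 0 1) u) :
    ∀ᵐ t, 0 < t → HasDerivAt (fun t => ∫ s in (0 : ℝ)..t, u s) (u t) t := by
  filter_upwards [ae_all_iff.2 fun n : ℕ =>
    (hu.intervalIntegrable le_rfl n.cast_nonneg).ae_hasDerivAt_integral] with t ht htpos
  obtain ⟨n, hn⟩ := exists_nat_ge t
  exact ht n (by rw [Set.uIcc_of_le (by positivity)]; exact ⟨htpos.le, hn⟩) 0 Set.left_mem_uIcc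

variable {E : Type*} [NormedAddCommGroup E] [InnerProductSpace ℝ E]
  {A₀ A₁ : E →L[ℝ] E}

lemma inner_affine_nonpos (h₀ : ∀ v, inner ℝ v (A₀ v) ≤ 0) (h₁ : ∀ v, inner ℝ v (A₁ v) ≤ 0)
    {r : ℝ} (hr : r ∈ Set.Icc (0 : ℝ) 1) (v : E) :
    inner ℝ v (A₀ v + r • (A₁ - A₀) v) ≤ 0 := by
  rw [inner_add_right, inner_smul_right, sub_apply, inner_sub_right]
  nlinarith [h₀ v, h₁ v, hr.1, hr.2]

/-- Solutions for the chattering law do not decay when the relaxed solution is isometric. -/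
lemma not_tendsto_zero_of_chatter [CompleteSpace E] (h₀ : ∀ v, inner ℝ v (A₀ v) ≤ 0)
    (h₁ : ∀ v, inner ℝ v (A₁ v) ≤ 0) {lam : ℝ → ℝ} (hlam : IsInput (Set.Icc 0 1) lam)
    {Z : ℝ → E} (hZ : LocLip Z)
    (hZd : ∀ᵐ t, 0 < t → HasDerivAt Z (A₀ (Z t) + lam t • (A₁ - A₀) (Z t)) t)
    (hZ₀ : ∀ t, 0 ≤ t → (A₀ + A₀.adjoint) (Z t) = 0)
    (hZ₁ : ∀ t, 0 ≤ t → (A₁ + A₁.adjoint) (Z t) = 0) (hne : Z 0 ≠ 0) :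
    ∃ N : ℕ, ∀ X : ℝ → E, X 0 = Z 0 → LocLip X →
      (∀ᵐ t, 0 < t →
        HasDerivAt X (A₀ (X t) + chatter N lam t • (A₁ - A₀) (X t)) t) →
      ¬ Tendsto X atTop (𝓝 0) := by
  set D := A₁ - A₀ with hD
  set c := ‖Z 0‖ with hc
  have hcpos : 0 < c := norm_pos_iff.2 hne
  set m := ‖A₀‖ + ‖D‖ with hm
  set R := 2 * (‖D‖ * m * c ^ 2) with hR
  have hR0 : 0 ≤ R := by positivity
  obtain ⟨N, hN⟩ := exists_nat_gt ((4 * R + 4 * (‖D‖ * c ^ 2)) / c ^ 2)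
  have hNpos : (0 : ℝ) < N := lt_of_le_of_lt (by positivity) hN
  have hN0 : 0 < N := by exact_mod_cast hNpos
  refine ⟨N, fun X hX0 hX hXd hlim => ?_⟩
  set u := chatter N lam with hu_def
  have hu : IsInput (Set.Icc 0 1) u := (chatter_isInput N lam).to_Icc
  have hZn : ∀ t, 0 ≤ t → ‖Z t‖ ≤ c := fun t ht =>
    norm_le_of_ae_dissipative hZ hZd
      (ae_of_all _ fun s hs => inner_affine_nonpos h₀ h₁ (hlam.2 s hs.le) _) le_rfl ht
  have hXn : ∀ t, 0 ≤ t → ‖X t‖ ≤ c := fun t ht => by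
    rw [hc, ← hX0]
    exact norm_le_of_ae_dissipative hX hXd
      (ae_of_all _ fun s hs => inner_affine_nonpos h₀ h₁ (hu.2 s hs.le) _) le_rfl ht
  set w : ℝ → ℝ := fun t => (∫ s in (0 : ℝ)..t, u s) - ∫ s in (0 : ℝ)..t, lam s with hw
  have hwb : ∀ t, 0 ≤ t → |w t| ≤ 2 / N * Real.exp (-t) := fun t ht =>
    abs_integral_chatter_sub_le hN0 hlam ht
  have hwl : LocLip w := by
    simpa [hw, sub_eq_add_neg] using
      hu.locLip_integral.add (hlam.locLip_integral.clm_comp (-ContinuousLinearMap.id ℝ ℝ))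
  -- The derivative of `⟪X, Z⟫` is `-(u - lam) * ⟪X, D Z⟫`, which is not small. As `w' = u - lam`,
  -- the corrector cancels it and leaves only terms with the small factor `w`.
  set F : ℝ → ℝ := fun t => inner ℝ (X t) (Z t) + w t * inner ℝ (X t) (D (Z t)) with hF
  have hFl : LocLip F := by
    have := (hX.inner_apply hZ).add (hwl.inner_apply (hX.inner_apply (hZ.clm_comp D)))
    simpa [hF, mul_comm] using this
  have hexpl : LocLip fun t : ℝ => -(R * (2 / N * Real.exp (-t))) := by
    intro T
    have h : ContDiff ℝ 1 fun t : ℝ => -(R * (2 / N * Real.exp (-t))) := by fun_prop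
    exact h.contDiffOn.exists_lipschitzOnWith one_ne_zero (convex_Icc 0 T) isCompact_Icc
  -- `|F'|` is at most `R * (2 / N) * exp (-t)`, the derivative of the added term, so the sum is
  -- nondecreasing and `F` loses at most `2 * R / N` over all time.
  have hmono : ∀ t, 0 ≤ t →
      F 0 + -(R * (2 / N * Real.exp (-0))) ≤ F t + -(R * (2 / N * Real.exp (-t))) := by
    intro t ht
    refine le_of_ae_deriv_nonneg (f := fun t => F t + -(R * (2 / N * Real.exp (-t)))) ht
      ((hFl.add hexpl).absolutelyContinuous le_rfl ht) ?_
    filter_upwards [hXd, hZd, hu.ae_hasDerivAt_integral, hlam.ae_hasDerivAt_integral]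
      with s hXs hZs hus hls hs
    have hs0 := hs.1
    have hX' := hXs hs0
    have hZ' := hZs hs0
    have hw' : HasDerivAt w (u s - lam s) s := (hus hs0).sub (hls hs0)
    have hDZ' := D.hasFDerivAt.comp_hasDerivAt s hZ'
    have he : HasDerivAt (fun t : ℝ => -(R * (2 / N * Real.exp (-t))))
        (R * (2 / N * Real.exp (-s))) s := by
      refine ((((hasDerivAt_id s).neg.exp).const_mul (2 / N : ℝ)).const_mul R).neg.congr_deriv ?_
      simp
    refine ⟨_, ((hX'.inner ℝ hZ').add (hw'.mul (hX'.inner ℝ hDZ'))).add he, ?_⟩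
    have hb : ∀ v r, r ∈ Set.Icc (0 : ℝ) 1 → ‖v‖ ≤ c → ‖A₀ v + r • D v‖ ≤ m * c :=
      fun v r hr hv => (affineCLM_norm_le A₀ D hr v).trans (by gcongr)
    set X' := A₀ (X s) + u s • D (X s) with hX'def
    set Z' := A₀ (Z s) + lam s • D (Z s) with hZ'def
    have e1 : inner ℝ (X s) Z' + inner ℝ X' (Z s) + (u s - lam s) * inner ℝ (X s) (D (Z s)) = 0 := by
      have i0 := inner_eq_neg_of_add_adjoint_eq_zero (hZ₀ s hs0.le) (X s)
      have i1 := inner_eq_neg_of_add_adjoint_eq_zero (hZ₁ s hs0.le) (X s)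
      rw [real_inner_comm (Z s) X']
      simp only [hX'def, hZ'def, hD, inner_add_right, inner_smul_right, sub_apply,
        inner_sub_right, i0, i1]
      ring
    have e2 : |inner ℝ (X s) (D Z') + inner ℝ X' (D (Z s))| ≤ R := by
      have j1 : |inner ℝ (X s) (D Z')| ≤ c * (‖D‖ * (m * c)) := by
        refine (abs_real_inner_le_norm _ _).trans ?_
        gcongr
        · exact hXn s hs0.le
        · exact (D.le_opNorm _).trans (by gcongr; exact hb _ _ (hlam.2 s hs0.le) (hZn s hs0.le))
      have j2 : |inner ℝ X' (D (Z s))| ≤ (m * c) * (‖D‖ * c) := by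
        refine (abs_real_inner_le_norm _ _).trans ?_
        gcongr
        · exact hb _ _ (hu.2 s hs0.le) (hXn s hs0.le)
        · exact (D.le_opNorm _).trans (by gcongr; exact hZn s hs0.le)
      refine (abs_add_le _ _).trans ((add_le_add j1 j2).trans (le_of_eq ?_))
      rw [hR]; ring
    have e3 : |w s * (inner ℝ (X s) (D Z') + inner ℝ X' (D (Z s)))|
        ≤ 2 / N * Real.exp (-s) * R := by
      rw [abs_mul]
      gcongr
      exact hwb s hs0.le
    have e4 := neg_abs_le (w s * (inner ℝ (X s) (D Z') + inner ℝ X' (D (Z s))))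
    simp only [Function.comp_apply] at *
    linarith
  have hlow : ∀ t, 0 ≤ t → c / 2 ≤ ‖X t‖ := by
    intro t ht
    have h1 := hmono t ht
    have h2 : F 0 = c ^ 2 := by
      simp only [hF, hw, hX0, intervalIntegral.integral_same, sub_zero, zero_mul, add_zero,
        real_inner_self_eq_norm_sq, hc]
    have h3 : 0 ≤ R * (2 / N * Real.exp (-t)) := by positivity
    have h4 : |w t * inner ℝ (X t) (D (Z t))| ≤ 2 / N * 1 * (c * (‖D‖ * c)) := by
      rw [abs_mul]
      gcongr
      · exact (hwb t ht).trans (by gcongr; exact Real.exp_le_one_iff.2 (by linarith))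
      · refine (abs_real_inner_le_norm _ _).trans ?_
        gcongr
        · exact hXn t ht
        · exact (D.le_opNorm _).trans (by gcongr; exact hZn t ht)
    have h5 := le_abs_self (w t * inner ℝ (X t) (D (Z t)))
    have h6 : inner ℝ (X t) (Z t) ≤ ‖X t‖ * c :=
      (real_inner_le_norm _ _).trans (by gcongr; exact hZn t ht)
    -- The choice of `N` makes the loss of `F` and the corrector together at most `c ^ 2 / 2`.
    have h7 : 2 / N * (R + ‖D‖ * c ^ 2) ≤ c ^ 2 / 2 := by
      rw [div_lt_iff₀ (by positivity)] at hN
      rw [div_mul_eq_mul_div, div_le_iff₀ hNpos]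
      nlinarith
    rw [h2, neg_zero, Real.exp_zero] at h1
    simp only [hF] at h1
    have h8 : c ^ 2 / 2 ≤ ‖X t‖ * c := by nlinarith
    by_contra hlt
    push Not at hlt
    nlinarith
  have h := hlim.norm
  rw [norm_zero] at h
  have h2 : c / 2 ≤ 0 := ge_of_tendsto h ((eventually_ge_atTop 0).mono hlow)
  linarith

variable {d : ℕ} {B₀ B₁ : Matrix (Fin d) (Fin d) ℝ}

lemma blockA_apply (lam : ℝ) (v : spaceK B₀ B₁) :
    blockA B₀ B₁ lam v = blockA B₀ B₁ 0 v + lam • (blockA B₀ B₁ 1 - blockA B₀ B₁ 0) v := by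
  simp only [blockA, sub_apply, ContinuousLinearMap.comp_apply, convOp_apply, map_add, map_smul,
    Submodule.subtypeL_apply]
  module

lemma coe_blockA_add_coe_blockC (lam : ℝ) (v : spaceK B₀ B₁) :
    (blockA B₀ B₁ lam v : EuclideanSpace ℝ (Fin d)) + blockC B₀ B₁ lam v
      = convOp B₀ B₁ lam v :=
  (spaceK B₀ B₁).starProjection_add_starProjection_orthogonal _

theorem IsGUAS.isUniformlyObservable (hS₀ : SymPartNonpos B₀) (hS₁ : SymPartNonpos B₁)
    (h : IsGUAS B₀ B₁) : IsUniformlyObservable B₀ B₁ := by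
  intro lam hlam p₁ p₂ x₁ x₂ hp hx₁ hx₂
  by_contra hvol
  have hnull : ∀ᵐ t, 0 ≤ t → blockC B₀ B₁ (lam t) (x₁ t) = blockC B₀ B₁ (lam t) (x₂ t) := by
    have := measure_eq_zero_iff_ae_notMem.1 (nonpos_iff_eq_zero.1 (not_lt.1 hvol))
    filter_upwards [this] with t ht h0
    by_contra hne
    exact ht ⟨h0, hne⟩
  have hAapp := fun t v => blockA_apply (B₀ := B₀) (B₁ := B₁) (lam t) v
  set ι := (spaceK B₀ B₁).subtypeL with hι
  set Z : ℝ → EuclideanSpace ℝ (Fin d) := fun t => ι (x₁ t) + (-ι) (x₂ t) with hZdef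
  have hZeq : ∀ t, Z t = ((x₁ t - x₂ t : spaceK B₀ B₁) : EuclideanSpace ℝ (Fin d)) := by
    intro t; simp [hZdef, hι, sub_eq_add_neg]
  have hZ : LocLip Z := ((hx₁.locLip hlam hAapp).clm_comp ι).add
    ((hx₂.locLip hlam hAapp).clm_comp (-ι))
  have hZd : ∀ᵐ t, 0 < t → HasDerivAt Z
      (euclOp B₀ (Z t) + lam t • (euclOp B₁ - euclOp B₀) (Z t)) t := by
    filter_upwards [hx₁.ae_hasDerivAt hlam hAapp, hx₂.ae_hasDerivAt hlam hAapp, hnull]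
      with t h1 h2 h3 ht
    have h4 := (ι.hasFDerivAt.comp_hasDerivAt t (h1 ht)).add
      ((-ι).hasFDerivAt.comp_hasDerivAt t (h2 ht))
    -- Equal outputs make the `Kᗮ` component of `B_lam Z` vanish, so the block equation on `K` is
    -- the full relaxed equation.
    refine h4.congr_deriv ?_
    rw [← hAapp, ← hAapp, ← convOp_apply, hZeq, ← coe_blockA_add_coe_blockC, map_sub, map_sub,
      h3 ht.le]
    simp [hι, sub_eq_add_neg]
  have hZK : ∀ t, Z t ∈ spaceK B₀ B₁ := fun t => by rw [hZeq]; exact Subtype.prop _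
  have hx0 : ∀ {p : spaceK B₀ B₁} {x}, IsTrajectory (fun t => blockA B₀ B₁ (lam t)) p x →
      x 0 = p := fun hx => by simpa using hx.2 0 le_rfl
  have hne : Z 0 ≠ 0 := by
    rw [hZeq, hx0 hx₁, hx0 hx₂]
    simpa [sub_eq_zero] using hp
  obtain ⟨N, hN⟩ := not_tendsto_zero_of_chatter hS₀.inner_nonpos hS₁.inner_nonpos hlam hZ hZd
    (fun t _ => (mem_spaceK.1 (hZK t)).1) (fun t _ => (mem_spaceK.1 (hZK t)).2) hne
  have hu := chatter_isInput N lam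
  have happ := fun t v => convOp_apply B₀ B₁ (chatter N lam t) v
  obtain ⟨X, hX⟩ := exists_isTrajectory hu.to_Icc happ (Z 0)
  refine hN X (by simpa using hX.2 0 le_rfl) (hX.locLip hu.to_Icc happ)
    (hX.ae_hasDerivAt hu.to_Icc happ) (h _ hu _ X hX)

end Relaxation

/-! ### Limits of translates and isometric relaxed trajectories. -/

section LimitTrajectory

/-- Limits of translates along an ultrafilter at infinity. -/
lemma exists_ultrafilter_limit {W : Type*} [NormedAddCommGroup W] [ProperSpace W]
    (𝒰 : Ultrafilter ℝ) {f : ℝ → ℝ → W} {b : ℝ → ℝ}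
    (hf : ∀ t, ∀ᶠ s in (𝒰 : Filter ℝ), ‖f s t‖ ≤ b t) :
    ∃ g : ℝ → W, ∀ t, Tendsto (fun s => f s t) 𝒰 (𝓝 (g t)) := by
  have : ∀ t, ∃ y, Tendsto (fun s => f s t) 𝒰 (𝓝 y) := by
    intro t
    obtain ⟨y, -, hy⟩ := (isCompact_closedBall (0 : W) (b t)).ultrafilter_le_nhds
      (𝒰.map fun s => f s t) (by
        rw [le_principal_iff, Ultrafilter.coe_map, mem_map]
        filter_upwards [hf t] with s hs
        simpa using hs)
    exact ⟨y, hy⟩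
  choose g hg using this
  exact ⟨g, hg⟩

variable {E : Type*} [NormedAddCommGroup E] [InnerProductSpace ℝ E]

/-- A limit of translates of a switched solution, with a limit `Λ` of the primitives `U` of the
switching laws. -/
lemma exists_limit_trajectory [ProperSpace E] {A₀ D : E →L[ℝ] E} {X : ℝ → E} {U : ℝ → ℝ}
    {c M C : ℝ}
    (hXl : ∀ a b, 0 ≤ a → 0 ≤ b → ‖X b - X a‖ ≤ M * |b - a|)
    (hUl : ∀ a b, 0 ≤ a → a ≤ b → U b - U a ∈ Set.Icc 0 (b - a))
    (hkey : ∀ a b, 0 ≤ a → 0 ≤ b →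
      ‖X b - X a - (b - a) • A₀ (X a) - (U b - U a) • D (X a)‖ ≤ C * (b - a) ^ 2)
    (hXc : Tendsto (fun t => ‖X t‖) atTop (𝓝 c)) :
    ∃ (x : ℝ → E) (Λ : ℝ → ℝ), (∀ t, ‖x t‖ = c) ∧ (∀ a b, ‖x b - x a‖ ≤ M * |b - a|) ∧
      (∀ a b, a ≤ b → Λ b - Λ a ∈ Set.Icc 0 (b - a)) ∧
      ∀ a b, ‖x b - x a - (b - a) • A₀ (x a) - (Λ b - Λ a) • D (x a)‖ ≤ C * (b - a) ^ 2 := by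
  -- An ultrafilter gives limits at all times at once, with no extraction of subsequences.
  let 𝒰 : Ultrafilter ℝ := Ultrafilter.of atTop
  have h𝒰 : (𝒰 : Filter ℝ) ≤ atTop := Ultrafilter.of_le _
  have hpos : ∀ t, ∀ᶠ s in (𝒰 : Filter ℝ), 0 ≤ s + t := fun t =>
    h𝒰 ((tendsto_atTop_add_const_right atTop t tendsto_id).eventually (eventually_ge_atTop 0))
  have hpos0 : ∀ᶠ s in (𝒰 : Filter ℝ), 0 ≤ s := by simpa using hpos 0
  have hnorm : ∀ t, Tendsto (fun s => ‖X (s + t)‖) 𝒰 (𝓝 c) := fun t =>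
    (hXc.comp (tendsto_atTop_add_const_right atTop t tendsto_id)).mono_left h𝒰
  obtain ⟨x, hx⟩ := exists_ultrafilter_limit 𝒰 (f := fun s t => X (s + t)) (b := fun _ => c + 1)
    (fun t => (hnorm t).eventually (ge_mem_nhds (lt_add_one c)))
  obtain ⟨Λ, hΛ⟩ := exists_ultrafilter_limit 𝒰 (f := fun s t => U (s + t) - U s)
    (b := fun t => |t|) (fun t => by
      filter_upwards [hpos t, hpos0] with s h1 h2
      rw [Real.norm_eq_abs]
      rcases le_total 0 t with ht | ht
      · have := hUl s (s + t) h2 (by linarith)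
        rw [abs_of_nonneg this.1, abs_of_nonneg ht]
        linarith [this.2]
      · have := hUl (s + t) s h1 (by linarith)
        rw [abs_of_nonpos ht, abs_of_nonpos (by linarith [this.1])]
        linarith [this.2])
  have hΛsub : ∀ a b, Tendsto (fun s => U (s + b) - U (s + a)) 𝒰 (𝓝 (Λ b - Λ a)) := fun a b => by
    simpa using (hΛ b).sub (hΛ a)
  refine ⟨x, Λ, fun t => tendsto_nhds_unique (hx t).norm (hnorm t), fun a b => ?_,
    fun a b hab => ?_, fun a b => ?_⟩
  · refine le_of_tendsto ((hx b).sub (hx a)).norm ?_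
    filter_upwards [hpos a, hpos b] with s h1 h2
    simpa using hXl _ _ h1 h2
  · refine isClosed_Icc.mem_of_tendsto (hΛsub a b) ?_
    filter_upwards [hpos a] with s h1
    simpa using hUl (s + a) (s + b) h1 (by linarith)
  · have hA := (A₀.continuous.tendsto _).comp (hx a)
    have hD := (D.continuous.tendsto _).comp (hx a)
    refine le_of_tendsto ((((hx b).sub (hx a)).sub (hA.const_smul (b - a))).sub
      ((hΛsub a b).smul hD)).norm ?_
    filter_upwards [hpos a, hpos b] with s h1 h2
    simpa using hkey _ _ h1 h2

/-- Inputs need not converge pointwise along translates, but their primitives do. An estimate in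
terms of primitives with quadratic error survives the limit and recovers the equation wherever `Λ`
is differentiable. -/
lemma hasDerivAt_of_quadratic_approx {A₀ D : E →L[ℝ] E} {x : ℝ → E} {Λ : ℝ → ℝ} {C a l : ℝ}
    (hkey : ∀ b, ‖x b - x a - (b - a) • A₀ (x a) - (Λ b - Λ a) • D (x a)‖ ≤ C * (b - a) ^ 2)
    (hΛ : HasDerivAt Λ l a) : HasDerivAt x (A₀ (x a) + l • D (x a)) a := by
  have h1 : HasDerivAt (fun b => x b - x a - (b - a) • A₀ (x a) - (Λ b - Λ a) • D (x a)) 0 a := by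
    rw [hasDerivAt_iff_isLittleO]
    simp only [sub_self, zero_smul, sub_zero, smul_zero]
    refine Asymptotics.IsBigO.trans_isLittleO (g := fun b => (b - a) ^ 2)
      (Asymptotics.IsBigO.of_bound C (Eventually.of_forall fun b => ?_)) ?_
    · rw [Real.norm_of_nonneg (sq_nonneg (b - a))]
      exact hkey b
    · have h2 : Tendsto (fun b : ℝ => b - a) (𝓝 a) (𝓝 0) := by
        have : Continuous fun b : ℝ => b - a := by fun_prop
        simpa using this.tendsto a
      exact (Asymptotics.isLittleO_pow_id (one_lt_two)).comp_tendsto h2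
  have h3 : HasDerivAt (fun b => (b - a) • A₀ (x a)) (A₀ (x a)) a := by
    simpa using ((hasDerivAt_id a).sub_const a).smul_const (A₀ (x a))
  have h4 : HasDerivAt (fun b => (Λ b - Λ a) • D (x a)) (l • D (x a)) a :=
    (hΛ.sub_const _).smul_const _
  have h5 := ((h1.add h3).add h4).add_const (x a)
  refine (h5.congr_deriv (by simp)).congr_of_eventuallyEq (Eventually.of_forall fun b => ?_)
  simp only [Pi.add_apply]
  abel

variable [CompleteSpace E]

/-- A differential equation which holds almost everywhere for a Lipschitz function, with a
continuous right-hand side, holds everywhere. -/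
lemma hasDerivAt_of_ae_hasDerivAt {x : ℝ → E} {K : NNReal} (hx : LipschitzWith K x)
    {A : E →L[ℝ] E} {a b : ℝ}
    (hd : ∀ᵐ t, t ∈ Set.Ioo a b → HasDerivAt x (A (x t)) t) :
    ∀ t ∈ Set.Ioo a b, HasDerivAt x (A (x t)) t := by
  intro t ht
  have hcont : Continuous fun s => A (x s) := A.continuous.comp hx.continuous
  have hder : ∀ s, HasDerivAt (fun r => ∫ q in t..r, A (x q)) (A (x s)) s := fun s =>
    intervalIntegral.integral_hasDerivAt_right (hcont.intervalIntegrable _ _)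
      (hcont.stronglyMeasurableAtFilter _ _) hcont.continuousAt
  have hsmooth : ContDiff ℝ 1 fun r => ∫ q in t..r, A (x q) := by
    rw [contDiff_one_iff_deriv]
    refine ⟨fun s => (hder s).differentiableAt, ?_⟩
    have : deriv (fun r => ∫ q in t..r, A (x q)) = fun s => A (x s) :=
      funext fun s => (hder s).deriv
    rw [this]; exact hcont
  have heq : ∀ s ∈ Set.Ioo a b, x s = x t + ∫ q in t..s, A (x q) := by
    intro s hs
    obtain ⟨c, hc⟩ := ((hx.lipschitzOnWith (s := Set.uIcc t s)).absolutelyContinuousOnInterval.sub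
      (hsmooth.contDiffOn.absolutelyContinuousOnInterval)).const_of_ae_hasDerivAt_zero (by
        filter_upwards [hd] with r h1 hr
        have hr' : r ∈ Set.Ioo a b :=
          ⟨(lt_min ht.1 hs.1).trans_le hr.1, hr.2.trans_lt (max_lt ht.2 hs.2)⟩
        simpa using (h1 hr').sub (hder r))
    have h1 := hc t Set.left_mem_uIcc
    have h2 := hc s Set.right_mem_uIcc
    simp only [Pi.sub_apply, intervalIntegral.integral_same, sub_zero] at h1 h2
    rw [h1, ← h2]; abel
  refine ((hder t).const_add (x t)).congr_of_eventuallyEq ?_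
  filter_upwards [Ioo_mem_nhds ht.1 ht.2] with s hs using heq s hs

/-- An isometric relaxed trajectory remains in the kernel of the symmetric part of `A₁`, if no
isometric trajectory of `A₀` exists. -/
lemma inner_eq_zero_of_isometric {A₀ A₁ : E →L[ℝ] E} (h₀ : ∀ v, inner ℝ v (A₀ v) ≤ 0)
    (h₁ : ∀ v, inner ℝ v (A₁ v) ≤ 0)
    (hur : ∀ v, (∀ n : ℕ, (A₀ + A₀.adjoint) ((A₀ ^ n) v) = 0) → v = 0)
    {x : ℝ → E} {K : NNReal} (hx : LipschitzWith K x) {l : ℝ → ℝ}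
    (hl : ∀ t, l t ∈ Set.Icc (0 : ℝ) 1)
    (hd : ∀ᵐ t, HasDerivAt x (A₀ (x t) + l t • (A₁ - A₀) (x t)) t) {c : ℝ} (hc : ∀ t, ‖x t‖ = c)
    (hc0 : c ≠ 0) (t : ℝ) : inner ℝ (x t) (A₁ (x t)) = 0 := by
  by_contra hne
  have hq : ∀ A : E →L[ℝ] E, Continuous fun s => inner ℝ (x s) (A (x s)) := fun A =>
    hx.continuous.inner (A.continuous.comp hx.continuous)
  have hopen : IsOpen {s | inner ℝ (x s) (A₁ (x s)) ≠ 0} :=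
    isOpen_ne_fun (hq A₁) continuous_const
  obtain ⟨a, b, ht, hsub⟩ := mem_nhds_iff_exists_Ioo_subset.1 (hopen.mem_nhds hne)
  -- Constant norm makes a convex combination of two nonpositive forms vanish; where the `A₁` form
  -- is negative, its weight is zero.
  have hae : ∀ᵐ s, s ∈ Set.Ioo a b → l s = 0 ∧ inner ℝ (x s) (A₀ (x s)) = 0 := by
    filter_upwards [hd] with s hs hmem
    have h1 := inner_eq_zero_of_norm_const (Eventually.of_forall hc) hs
    rw [inner_add_right, inner_smul_right, sub_apply, inner_sub_right] at h1
    have h2 := lt_of_le_of_ne (h₁ (x s)) (hsub hmem)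
    have h3 := h₀ (x s)
    have hl0 : l s = 0 := by
      by_contra hl0
      have := lt_of_le_of_ne (hl s).1 (Ne.symm hl0)
      nlinarith [(hl s).2]
    exact ⟨hl0, by simpa [hl0] using h1⟩
  have hder := hasDerivAt_of_ae_hasDerivAt hx (A := A₀) (a := a) (b := b) (by
    filter_upwards [hd, hae] with s h1 h2 hs
    simpa [(h2 hs).1] using h1)
  have hq0 : Set.EqOn (fun s => inner ℝ (x s) (A₀ (x s))) (fun _ => 0) (Set.Ioo a b) := by
    refine Measure.eqOn_open_of_ae_eq (μ := volume) ?_ isOpen_Ioo (hq A₀).continuousOn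
      continuousOn_const
    rw [EventuallyEq, ae_restrict_iff' measurableSet_Ioo]
    filter_upwards [hae] with s hs hmem using (hs hmem).2
  -- Differentiating the identity for `n` along `x' = A₀ x` gives the one for `n + 1`.
  have hpow : ∀ n : ℕ, ∀ s ∈ Set.Ioo a b, (A₀ + A₀.adjoint) ((A₀ ^ n) (x s)) = 0 := by
    intro n
    induction n with
    | zero => exact fun s hs => add_adjoint_apply_eq_zero h₀ (hq0 hs)
    | succ n ih =>
      intro s hs
      have h1 := ((A₀ + A₀.adjoint) ∘L (A₀ ^ n)).hasFDerivAt.comp_hasDerivAt s (hder s hs)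
      have h2 : HasDerivAt (((A₀ + A₀.adjoint) ∘L (A₀ ^ n)) ∘ x) 0 s := by
        refine (hasDerivAt_const s (0 : E)).congr_of_eventuallyEq ?_
        filter_upwards [Ioo_mem_nhds hs.1 hs.2] with r hr using ih r hr
      rw [pow_succ]
      exact h1.unique h2
  have : x t = 0 := hur _ fun n => hpow n t ht
  exact hc0 (by rw [← hc t, this, norm_zero])

end LimitTrajectory

/-! ### Observability implies GUAS. -/

section Observability

lemma isTrajectory_of_ae_hasDerivAt {V : Type*} [NormedAddCommGroup V] [NormedSpace ℝ V]
    [CompleteSpace V] {A₀ D : V →L[ℝ] V} {u : ℝ → ℝ} {L : ℝ → V →L[ℝ] V}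
    (hu : IsInput (Set.Icc 0 1) u) (hL : ∀ t v, L t v = A₀ v + u t • D v) {x : ℝ → V}
    (hc : Continuous x) (hx : LocLip x)
    (hd : ∀ᵐ t, HasDerivAt x (A₀ (x t) + u t • D (x t)) t) : IsTrajectory L (x 0) x := by
  have hint := fun a b (ha : (0 : ℝ) ≤ a) (hb : (0 : ℝ) ≤ b) =>
    affine_intervalIntegrable A₀ D hu hc.continuousOn (x := x) ha hb
  refine ⟨hc.continuousOn, fun t ht => ?_⟩
  have hI : LocLip fun t => ∫ s in (0 : ℝ)..t, (A₀ (x s) + u s • D (x s)) := by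
    refine locLip_of_ae_bound (x₀ := 0) (fun t _ => (zero_add _).symm) hint fun T => ?_
    obtain ⟨M, hM⟩ := isCompact_Icc.exists_bound_of_continuousOn
      (hc.continuousOn (s := Set.Icc 0 T))
    refine ⟨(‖A₀‖ + ‖D‖) * M, fun t ht => (affineCLM_norm_le A₀ D (hu.2 t ht.1) _).trans ?_⟩
    gcongr
    exact hM t ht
  obtain ⟨c, hc⟩ := ((hx.absolutelyContinuous le_rfl ht).sub
    (hI.absolutelyContinuous le_rfl ht)).const_of_ae_hasDerivAt_zero (by
      filter_upwards [hd, (hint 0 t le_rfl ht).ae_hasDerivAt_integral] with s h1 h2 hs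
      simpa using h1.sub (h2 hs 0 Set.left_mem_uIcc))
  have h1 := hc 0 Set.left_mem_uIcc
  have h2 := hc t Set.right_mem_uIcc
  simp only [Pi.sub_apply, intervalIntegral.integral_same, sub_zero] at h1 h2
  simp only [hL]
  rw [h1, ← h2]; abel

variable {E : Type*} [NormedAddCommGroup E] [InnerProductSpace ℝ E] [ProperSpace E]
  [CompleteSpace E]

/-- If some solution does not decay, the relaxed system has an isometric trajectory. -/
lemma exists_isometric_trajectory {A₀ A₁ : E →L[ℝ] E} (h₀ : ∀ v, inner ℝ v (A₀ v) ≤ 0)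
    (h₁ : ∀ v, inner ℝ v (A₁ v) ≤ 0) {u : ℝ → ℝ} (hu : IsInput (Set.Icc 0 1) u)
    {L : ℝ → E →L[ℝ] E} (hL : ∀ t v, L t v = A₀ v + u t • (A₁ - A₀) v) {X₀ : E} {X : ℝ → E}
    (hX : IsTrajectory L X₀ X) (hlim : ¬ Tendsto X atTop (𝓝 0)) :
    ∃ (x : ℝ → E) (l : ℝ → ℝ) (c : ℝ) (K : NNReal), c ≠ 0 ∧ (∀ t, ‖x t‖ = c) ∧
      LipschitzWith K x ∧ Measurable l ∧ (∀ t, l t ∈ Set.Icc (0 : ℝ) 1) ∧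
      ∀ᵐ t, HasDerivAt x (A₀ (x t) + l t • (A₁ - A₀) (x t)) t := by
  set D := A₁ - A₀ with hD
  have hXl := hX.locLip hu hL
  have hanti : ∀ a b, 0 ≤ a → a ≤ b → ‖X b‖ ≤ ‖X a‖ := fun a b ha hab =>
    norm_le_of_ae_dissipative hXl (hX.ae_hasDerivAt hu hL)
      (ae_of_all _ fun s hs => inner_affine_nonpos h₀ h₁ (hu.2 s hs.le) _) ha hab
  obtain ⟨c, hc⟩ : ∃ c, Tendsto (fun t => ‖X t‖) atTop (𝓝 c) := by
    -- `X` is uncontrolled at negative times, hence the truncation.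
    have h1 : Antitone fun t : ℝ => ‖X (max t 0)‖ := fun a b hab =>
      hanti _ _ (le_max_right _ _) (max_le_max_right 0 hab)
    have h2 := tendsto_atTop_ciInf h1 ⟨0, by rintro _ ⟨t, rfl⟩; exact norm_nonneg _⟩
    refine ⟨_, h2.congr' ?_⟩
    filter_upwards [eventually_ge_atTop 0] with t ht
    rw [max_eq_left ht]
  have hc0 : c ≠ 0 := by
    rintro rfl
    exact hlim (tendsto_zero_iff_norm_tendsto_zero.2 hc)
  set m := ‖A₀‖ + ‖D‖ with hm
  set M := m * ‖X 0‖ with hM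
  set U : ℝ → ℝ := fun t => ∫ s in (0 : ℝ)..t, u s with hU
  have hmin : ∀ {a b r : ℝ}, 0 ≤ a → 0 ≤ b → r ∈ Set.uIoc a b → 0 ≤ r := fun ha hb hr =>
    (le_min ha hb).trans (Set.uIoc_subset_uIcc hr).1
  have hXint := fun a b (ha : (0 : ℝ) ≤ a) (hb : (0 : ℝ) ≤ b) =>
    affine_intervalIntegrable A₀ D hu hX.1 ha hb
  have hXsub : ∀ a b, 0 ≤ a → 0 ≤ b →
      X b - X a = ∫ r in a..b, (A₀ (X r) + u r • D (X r)) := by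
    intro a b ha hb
    rw [hX.eq_integral hL b hb, hX.eq_integral hL a ha, add_sub_add_left_eq_sub,
      intervalIntegral.integral_interval_sub_left (hXint 0 b le_rfl hb) (hXint 0 a le_rfl ha)]
  have hXM : ∀ a b, 0 ≤ a → 0 ≤ b → ‖X b - X a‖ ≤ M * |b - a| := by
    intro a b ha hb
    rw [hXsub a b ha hb]
    refine intervalIntegral.norm_integral_le_of_norm_le_const fun r hr => ?_
    have hr0 := hmin ha hb hr
    exact (affineCLM_norm_le A₀ D (hu.2 r hr0) _).trans
      (mul_le_mul_of_nonneg_left (hanti 0 r le_rfl hr0) (by positivity))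
  have hUsub : ∀ a b, 0 ≤ a → 0 ≤ b → U b - U a = ∫ r in a..b, u r := fun a b ha hb =>
    intervalIntegral.integral_interval_sub_left (hu.intervalIntegrable le_rfl hb)
      (hu.intervalIntegrable le_rfl ha)
  have hUl : ∀ a b, 0 ≤ a → a ≤ b → U b - U a ∈ Set.Icc 0 (b - a) := fun a b ha hab => by
    rw [hUsub a b ha (ha.trans hab)]
    exact hu.integral_mem ha hab
  have hkey : ∀ a b, 0 ≤ a → 0 ≤ b →
      ‖X b - X a - (b - a) • A₀ (X a) - (U b - U a) • D (X a)‖ ≤ m * M * (b - a) ^ 2 := by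
    intro a b ha hb
    -- The error of freezing the state at `X a`; the Lipschitz bound on `X` makes it quadratic.
    have e : X b - X a - (b - a) • A₀ (X a) - (U b - U a) • D (X a)
        = ∫ r in a..b, (A₀ (X r - X a) + u r • D (X r - X a)) := by
      have e1 : ∫ r in a..b, (A₀ (X a) + u r • D (X a))
          = (b - a) • A₀ (X a) + (U b - U a) • D (X a) := by
        rw [intervalIntegral.integral_add intervalIntegrable_const
          ((hu.intervalIntegrable ha hb).smul_continuousOn continuousOn_const), intervalIntegral.integral_const,
          intervalIntegral.integral_smul_const, hUsub a b ha hb]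
      rw [sub_sub, ← e1, hXsub a b ha hb, ← intervalIntegral.integral_sub (hXint a b ha hb)
        (affine_intervalIntegrable A₀ D hu (x := fun _ => X a) continuousOn_const ha hb)]
      refine intervalIntegral.integral_congr fun r _ => ?_
      simp only [map_sub, smul_sub]
      abel
    rw [e]
    have : m * M * (b - a) ^ 2 = m * (M * |b - a|) * |b - a| := by
      rw [← sq_abs (b - a)]; ring
    rw [this]
    refine intervalIntegral.norm_integral_le_of_norm_le_const fun r hr => ?_
    have hr0 := hmin ha hb hr
    refine (affineCLM_norm_le A₀ D (hu.2 r hr0) _).trans ?_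
    gcongr
    refine (hXM a r ha hr0).trans ?_
    gcongr ?_ * ?_
    exact Set.abs_sub_left_of_mem_uIcc (Set.uIoc_subset_uIcc hr)
  obtain ⟨x, Λ, hxc, hxM, hΛ, hxkey⟩ := exists_limit_trajectory hXM hUl hkey hc
  have hmonoΛ : Monotone Λ := fun a b hab => sub_nonneg.1 (hΛ a b hab).1
  have hlipΛ : LipschitzWith 1 Λ := LipschitzWith.of_le_add fun a b => by
    rw [Real.dist_eq]
    rcases le_total a b with h | h
    · linarith [hmonoΛ h, abs_nonneg (a - b)]
    · linarith [(hΛ b a h).2, le_abs_self (a - b)]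
  have hM0 : 0 ≤ M := by positivity
  -- `deriv Λ` is measurable and takes the default value `0` where `Λ` is not differentiable, so it
  -- stays in `[0, 1]` everywhere.
  refine ⟨x, deriv Λ, c, M.toNNReal, hc0, hxc, LipschitzWith.of_dist_le_mul fun a b => ?_,
    measurable_deriv Λ, fun t => ⟨hmonoΛ.deriv_nonneg, ?_⟩, ?_⟩
  · rw [Real.coe_toNNReal _ hM0, dist_eq_norm, Real.dist_eq]
    exact hxM b a
  · exact (le_abs_self _).trans (by simpa using norm_deriv_le_of_lipschitz hlipΛ (x₀ := t))
  · filter_upwards [hmonoΛ.ae_differentiableAt] with t ht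
    exact hasDerivAt_of_quadratic_approx (fun b => hxkey t b) ht.hasDerivAt

variable {d : ℕ} {B₀ B₁ : Matrix (Fin d) (Fin d) ℝ}

theorem IsUniformlyObservable.isGUAS (hB₀ : IsHurwitz B₀) (hB₁ : IsHurwitz B₁)
    (hS₀ : SymPartNonpos B₀) (hS₁ : SymPartNonpos B₁) (h : IsUniformlyObservable B₀ B₁) :
    IsGUAS B₀ B₁ := by
  intro u hu X₀ X hX
  by_contra hlim
  obtain ⟨x, l, c, K, hc0, hxc, hxK, hlm, hl, hd⟩ := exists_isometric_trajectory
    hS₀.inner_nonpos hS₁.inner_nonpos hu.to_Icc (fun t v => convOp_apply B₀ B₁ (u t) v) hX hlim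
  -- The same trajectory with the two matrices exchanged and input `1 - l`, so that both quadratic
  -- forms are shown to vanish.
  have hd' : ∀ᵐ t, HasDerivAt x
      (euclOp B₁ (x t) + (1 - l t) • (euclOp B₀ - euclOp B₁) (x t)) t := by
    filter_upwards [hd] with t ht
    refine ht.congr_deriv ?_
    simp only [sub_apply]
    module
  have hmem : ∀ t, x t ∈ spaceK B₀ B₁ := fun t => mem_spaceK.2
    ⟨add_adjoint_apply_eq_zero hS₀.inner_nonpos <|
      inner_eq_zero_of_isometric hS₁.inner_nonpos hS₀.inner_nonpos
        (fun v => hB₁.eq_zero_of_forall_pow_euclOp) hxK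
        (fun t => ⟨by linarith [(hl t).2], by linarith [(hl t).1]⟩) hd' hxc hc0 t,
    add_adjoint_apply_eq_zero hS₁.inner_nonpos <|
      inner_eq_zero_of_isometric hS₀.inner_nonpos hS₁.inner_nonpos
        (fun v => hB₀.eq_zero_of_forall_pow_euclOp) hxK hl hd hxc hc0 t⟩
  set y : ℝ → spaceK B₀ B₁ := fun t => ⟨x t, hmem t⟩ with hy
  have hyl : LipschitzWith K y := fun a b => hxK a b
  have hinput : IsInput (Set.Icc 0 1) l := ⟨hlm, fun t _ => hl t⟩
  have hAapp := fun t v => blockA_apply (B₀ := B₀) (B₁ := B₁) (l t) v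
  have hconv : ∀ᵐ t, HasDerivAt x (convOp B₀ B₁ (l t) (y t)) t := by
    filter_upwards [hd] with t ht
    rw [convOp_apply]
    exact ht
  have hyd : ∀ᵐ t, HasDerivAt y (blockA B₀ B₁ (l t) (y t)) t := by
    filter_upwards [hconv] with t ht
    have h1 := ((spaceK B₀ B₁).orthogonalProjectionOnto).hasFDerivAt.comp_hasDerivAt t ht
    refine h1.congr_of_eventuallyEq (Eventually.of_forall fun s => ?_)
    exact ((spaceK B₀ B₁).orthogonalProjectionOnto_mem_subspace_eq_self (y s)).symm
  -- The `Kᗮ` projection of `x` is identically zero, hence so is that of its derivative.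
  have hC : ∀ᵐ t, blockC B₀ B₁ (l t) (y t) = 0 := by
    filter_upwards [hconv] with t ht
    have h1 := ((spaceK B₀ B₁)ᗮ.orthogonalProjectionOnto).hasFDerivAt.comp_hasDerivAt t ht
    refine h1.unique ((hasDerivAt_const t 0).congr_of_eventuallyEq
      (Eventually.of_forall fun s => ?_))
    exact Submodule.orthogonalProjectionOnto_orthogonal_apply_eq_zero (hmem s)
  have hytraj : IsTrajectory (fun t => blockA B₀ B₁ (l t)) (y 0) y :=
    isTrajectory_of_ae_hasDerivAt hinput hAapp hyl.continuous
      (fun T => ⟨K, hyl.lipschitzOnWith⟩) (by simpa only [hAapp] using hyd)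
  have h0traj : IsTrajectory (fun t => blockA B₀ B₁ (l t)) 0 (fun _ => 0) :=
    ⟨continuousOn_const, fun t _ => by simp⟩
  have hne : y 0 ≠ 0 := fun h0 => hc0 (by
    rw [← hxc 0, show x 0 = 0 from congrArg Subtype.val h0, norm_zero])
  refine (h l hinput (y 0) 0 y _ hne hytraj h0traj).ne' ?_
  rw [measure_eq_zero_iff_ae_notMem]
  filter_upwards [hC] with t ht hmem
  exact hmem.2 (by rw [ht, map_zero])

end Observability

theorem theorem2 (d : ℕ) (B₀ B₁ : Matrix (Fin d) (Fin d) ℝ)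
    (hB₀ : IsHurwitz B₀) (hB₁ : IsHurwitz B₁)
    (hS₀ : SymPartNonpos B₀) (hS₁ : SymPartNonpos B₁) :
    IsGUAS B₀ B₁ ↔ IsUniformlyObservable B₀ B₁ :=
  ⟨fun h => h.isUniformlyObservable hS₀ hS₁, fun h => h.isGUAS hB₀ hB₁ hS₀ hS₁⟩
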